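/- Conventions. For a valued field $F$ with valuation $|\cdot|$ (written multiplicatively, with $|0|=0$) and $\lambda\le 1$ in its value group, $\mathrm{RV}_{\lambda,F}:=(F^\times/B_{<\lambda}(1))\cup\{0\}$, where $B_{<\lambda}(1)=\{x : |x-1|<\lambda\}$, and $\mathrm{rv}_\lambda\colon F\to \mathrm{RV}_{\lambda,F}$ is the canonical map; the index $\lambda$ is omitted if $\lambda=1$. A set $X\subseteq F$ is $\lambda$-prepared by a finite set $C\subseteq F$ if whether $x$ lies in $X$ depends only on the tuple $(\mathrm{rv}_\lambda(x-c))_{c\in C}$. Let $T$ be the theory of a valued field of characteristic $0$ in a language expanding the valued field language. For $T$ of equi-characteristic $0$, $T$ is $0$-h-minimal if for every model $N$ of $T$ and every $A\subseteq N$, every $(A\cup \mathrm{RV}_N)$-definable set $X\subseteq N$ is $1$-prepared by some finite $A$-definable set $C\subseteq N$. The theory $T$ is $0$-h$^{\mathrm{mix}}$-minimal if for every model $N$ of $T$, every $A\subseteq N$ and every integer $m'\ge 1$, every $(A\cup \mathrm{RV}_{|m'|,N})$-definable set $X\subseteq N$ is $|m|$-prepared, for some integer $m\ge 1$, by some finite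 $A$-definable set $C\subseteq N$. A valued field of finite residue characteristic $p$ is finitely ramified if only finitely many elements of its value group lie between $|p|$ and $1$. Proposition. Let $K$ be a valued field of characteristic $0$, considered as a structure in a language expanding the valued field language, such that either (i) $K$ has residue characteristic $0$ and $\mathrm{Th}(K)$ is $0$-h-minimal, or (ii) $K$ has finite residue characteristic, is finitely ramified, and $\mathrm{Th}(K)$ is $0$-h$^{\mathrm{mix}}$-minimal. Let $M\succ K$ be an elementary extension and let $\alpha\in M$ be a pseudo-Cauchy limit over $K$, i.e. for every $a\in K$ there is $a'\in K$ with $|\alpha-a'|<|\alpha-a|$. Let $L:=\mathrm{acl}_{\mathrm{VF}}(K,\alpha)$ be the field-sort part of the model-theoretic algebraic closure of $K\cup\{\alpha\}$ in $M$, i.e. the union of all finite $(K\cup\{\alpha\})$-definable subsets of $M$. Then $L$ is (the universe of) a substructure of $M$ which is an elementary extension of $K$, and $\mathrm{RV}_L=\mathrm{RV}_K$ (as subsets of $\mathrm{RV}_M$); that is, $L$ is an immediate elementary extension of $K$: it has the same value group and the same residue field as $K$. Moreover $L=\mathrm{dcl}_{\mathrm{VF}}(K,\alpha)$, i.e. for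 every $\beta\in L$ the set $\{\beta\}$ is definable in $M$ with parameters from $K\cup\{\alpha\}$. -/

import Mathlib

open scoped FirstOrder

universe u v w

namespace HMin

/-- The single relation symbol, of arity one, naming the valuation ring. -/
inductive ValRel : ℕ → Type
  | integer : ValRel 1

/-- The language of valued fields: the language of rings together with a unary predicate for the
valuation ring. -/
def valuedField : FirstOrder.Language.{0, 0} :=
  FirstOrder.Language.ring.sum ⟨fun _ => Empty, ValRel⟩

/-- The structure on a field `N` with valuation ring `O` in the language of valued fields. -/
@[reducible] noncomputable def valuedFieldStructure {N : Type w} [Field N] (O : ValuationSubring N) :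
    valuedField.Structure N :=
  letI : FirstOrder.Language.ring.Structure N := (FirstOrder.Ring.compatibleRingOfRing N).toStructure
  letI : FirstOrder.Language.Structure ⟨fun _ => Empty, ValRel⟩ N :=
    { funMap := fun s _ => s.elim
      RelMap := fun r x => match r, x with
        | ValRel.integer, x => x 0 ∈ O }
  FirstOrder.Language.sumStructure FirstOrder.Language.ring ⟨fun _ => Empty, ValRel⟩ N

/-- The `L`-structure on `N` expands the valued field `(N, O)`, where `φ` exhibits `L` as a
language expanding the language of valued fields. -/
def IsExpansion {L : FirstOrder.Language.{u, v}} (φ : valuedField →ᴸ L) {N : Type w} [Field N]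
    (O : ValuationSubring N) [L.Structure N] : Prop :=
  letI := valuedFieldStructure O
  φ.IsExpansionOn N

section RV

variable {N : Type w} [Field N] (O : ValuationSubring N)

/-- Elements `lam ≤ 1` of the value group (so `lam ≠ 0`). -/
def Radius : Type w := {lam : O.ValueGroup // lam ≠ 0 ∧ lam ≤ 1}

/-- The radius `1`. -/
noncomputable def Radius.one : Radius O := ⟨1, one_ne_zero, le_rfl⟩

theorem valuation_natCast_le_one (m : ℕ) : O.valuation (m : N) ≤ 1 :=
  (O.valuation_le_one_iff _).2 (natCast_mem O m)

/-- The radius `|m|`, for a positive integer `m`. -/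
noncomputable def Radius.ofNat [CharZero N] (m : ℕ+) : Radius O :=
  ⟨O.valuation ((m : ℕ) : N),
    (Valuation.ne_zero_iff _).2 (Nat.cast_ne_zero.2 m.ne_zero),
    valuation_natCast_le_one O m⟩

variable {O}

theorem valuation_eq_one_of_sub_one_lt {lam : Radius O} {x : N}
    (hx : O.valuation (x - 1) < lam.1) : O.valuation x = 1 := by
  have h : O.valuation (x - 1) < O.valuation 1 := by
    rw [map_one]; exact hx.trans_le lam.2.2
  simpa using Valuation.map_eq_of_sub_lt _ h

/-- The open ball of radius `lam` around `1`, as a subgroup of the multiplicative group. -/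
def oneBall (lam : Radius O) : Subgroup Nˣ where
  carrier := {x | O.valuation ((x : N) - 1) < lam.1}
  one_mem' := by simpa using zero_lt_iff.2 lam.2.1
  mul_mem' := by
    intro a b ha hb
    simp only [Set.mem_ofPred_eq, Units.val_mul] at ha hb ⊢
    have e : (a : N) * b - 1 = a * (b - 1) + (a - 1) := by ring
    rw [e]
    refine Valuation.map_add_lt _ ?_ ha
    rwa [map_mul, valuation_eq_one_of_sub_one_lt ha, one_mul]
  inv_mem' := by
    intro a ha
    simp only [Set.mem_ofPred_eq] at ha ⊢
    have e : ((a⁻¹ : Nˣ) : N) - 1 = -((a : N)⁻¹ * (a - 1)) := by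
      rw [Units.val_inv_eq_inv_val, mul_sub, inv_mul_cancel₀ a.ne_zero, mul_one, neg_sub]
    rw [e, Valuation.map_neg, map_mul, map_inv₀, valuation_eq_one_of_sub_one_lt ha, inv_one,
      one_mul]
    exact ha

/-- The leading term structure `RV_lam = (Nˣ / B_{<lam}(1)) ∪ {0}`. -/
abbrev RV (lam : Radius O) : Type w := WithZero (Nˣ ⧸ oneBall lam)

open Classical in
/-- The canonical map `rv_lam : N → RV_lam`. -/
noncomputable def rv (lam : Radius O) (x : N) : RV lam :=
  if h : x = 0 then 0 else ((Units.mk0 x h : Nˣ ⧸ oneBall lam) : WithZero (Nˣ ⧸ oneBall lam))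

/-- Whether `x` lies in `X` depends only on the tuple `(rv_lam (x - c))_{c ∈ C}`. -/
def Prepares (lam : Radius O) (C X : Set N) : Prop :=
  ∀ x x' : N, (∀ c ∈ C, rv lam (x - c) = rv lam (x' - c)) → (x ∈ X ↔ x' ∈ X)

/-- `X ⊆ N` is `(A ∪ RV_lam)`-definable: it is the fibre, over some tuple of elements of the
imaginary sort `RV_lam`, of an `A`-definable subset `W` of `N × RV_lam ^ q`; here `W` is
`A`-definable if its preimage in `N ^ (1 + q)` is. -/
def DefinableOverRV (L : FirstOrder.Language.{u, v}) [L.Structure N] (A : Set N) (lam : Radius O)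
    (X : Set N) : Prop :=
  ∃ (q : ℕ) (W : Set (N × (Fin q → RV lam))) (ξ : Fin q → RV lam),
    A.Definable L {z : Fin (q + 1) → N | (z 0, fun i : Fin q => rv lam (z i.succ)) ∈ W} ∧
      X = {x | (x, ξ) ∈ W}

variable (O)

/-- For residue characteristic `p`: there are only finitely many values between `|p|` and `1`. -/
def IsFinitelyRamified (p : ℕ) : Prop :=
  {γ : O.ValueGroup | O.valuation (p : N) ≤ γ ∧ γ ≤ 1}.Finite

/-- `α` is a pseudo-Cauchy limit over `R`. -/
def IsPCL (R : Set N) (α : N) : Prop :=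
  ∀ a ∈ R, ∃ a' ∈ R, O.valuation (α - a') < O.valuation (α - a)

/-- `S` and `R` (subfields, `R ⊆ S`) have the same value group and the same residue field, both
seen inside those of `N`. -/
def IsImmediate (R S : Set N) : Prop :=
  O.valuation '' S = O.valuation '' R ∧
    IsLocalRing.residue O '' {x : O | (x : N) ∈ S} = IsLocalRing.residue O '' {x : O | (x : N) ∈ R}

end RV

/-- The theory `T` (of valued fields of equi-characteristic `0`) is `0`-h-minimal: in every model,
every `(A ∪ RV)`-definable subset of the field is prepared by a finite `A`-definable set. -/
def IsZeroHMinimal {L : FirstOrder.Language.{u, v}} (φ : valuedField →ᴸ L) (T : L.Theory) : Prop :=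
  ∀ (N : Type w) [Field N] [CharZero N] (O : ValuationSubring N) [L.Structure N],
    IsExpansion φ O → N ⊨ T →
    ∀ A X : Set N, DefinableOverRV L A (Radius.one O) X →
      ∃ C : Set N, C.Finite ∧ A.Definable₁ L C ∧ Prepares (Radius.one O) C X

/-- The theory `T` (of valued fields of characteristic `0`) is `0`-h^mix-minimal: in every model,
for every integer `m' ≥ 1`, every `(A ∪ RV_{|m'|})`-definable subset of the field is
`|m|`-prepared, for some integer `m ≥ 1`, by a finite `A`-definable set. -/
def IsZeroHMixMinimal {L : FirstOrder.Language.{u, v}} (φ : valuedField →ᴸ L) (T : L.Theory) : Prop :=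
  ∀ (N : Type w) [Field N] [CharZero N] (O : ValuationSubring N) [L.Structure N],
    IsExpansion φ O → N ⊨ T →
    ∀ (m' : ℕ+) (A X : Set N), DefinableOverRV L A (Radius.ofNat O m') X →
      ∃ (m : ℕ+) (C : Set N), C.Finite ∧ A.Definable₁ L C ∧ Prepares (Radius.ofNat O m) C X

/-- The model-theoretic algebraic closure of `A`: the union of the finite `A`-definable sets. -/
def acl (L : FirstOrder.Language.{u, v}) {N : Type w} [L.Structure N] (A : Set N) : Set N :=
  {b | ∃ D : Set N, D.Finite ∧ A.Definable₁ L D ∧ b ∈ D}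

/-- The definable closure of `A`: the elements `b` such that `{b}` is `A`-definable. -/
def dcl (L : FirstOrder.Language.{u, v}) {N : Type w} [L.Structure N] (A : Set N) : Set N :=
  {b | A.Definable₁ L {b}}

end HMin

namespace HMin

/-! ### Leading terms expressed through the valuation. -/

section RVBasic

variable {N : Type w} [Field N] {O : ValuationSubring N}

/-! Let A be the image of K in M. Both hypotheses yield one mixed form of preparation, since |m| = 1
for every m ≥ 1 in residue characteristic 0. A compactness argument makes it uniform
(`exists_uniform_preparation`): for an A-definable W ⊆ M², one finite A-definable C and one m
prepare, for all ξ at once, the set of x whose fibre W_x meets the `rv`-class of ξ.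

The key point is `exists_rv_eq_of_definable`. Let Z = W_α be nonempty and definable over A and α. By
Tarski-Vaught the finite set C lies in A, and finite ramification lets some a ∈ A be so close to α
that no point of C separates α from a up to `rv_m`. Hence W_α and W_a have the same leading terms.
The saturation of W_a under the `rv` relation is A-definable, so it has a point in A: Z contains an
element with a leading term coming from A.

Everything else follows by choosing Z. Differences of points of a finite set D give a definable way
to split D, so acl = dcl (`acl_eq_dcl`). Displacements from a nearest preparing point give the
Tarski-Vaught test for dcl (`meetsDefinable_dcl`). Singletons give RV_L = RV_K. -/

theorem rv_eq_rv_iff {lam : Radius O} {x y : N} :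
    rv lam x = rv lam y ↔ x = y ∨ O.valuation (x - y) < lam.1 * O.valuation y := by
  by_cases hy : y = 0
  · subst hy
    by_cases hx : x = 0 <;> simp [rv, hx]
  have hvy : 0 < O.valuation y := zero_lt_iff.2 ((Valuation.ne_zero_iff _).2 hy)
  by_cases hx : x = 0
  · subst hx
    have h : ¬ O.valuation y < lam.1 * O.valuation y := by
      refine not_lt.2 ?_
      calc lam.1 * O.valuation y ≤ 1 * O.valuation y := mul_le_mul_left lam.2.2 _
        _ = O.valuation y := one_mul _
    simp [rv, hy, Ne.symm hy, Valuation.map_neg, h]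
  have e : rv lam x = rv lam y ↔ O.valuation (y⁻¹ * x - 1) < lam.1 := by
    rw [eq_comm]
    simp only [rv, hx, hy, dif_neg, not_false_eq_true]
    rw [WithZero.coe_inj, QuotientGroup.eq]
    simp [oneBall, ← Subgroup.mem_carrier]
  have e2 : y⁻¹ * x - 1 = (x - y) / y := by field_simp
  rw [e, e2, map_div₀, div_lt_iff₀ hvy]
  refine ⟨Or.inr, ?_⟩
  rintro (rfl | h)
  · simpa using mul_pos (zero_lt_iff.2 lam.2.1) hvy
  · exact h

theorem rv_ofNat_eq_iff [CharZero N] {m : ℕ+} {x y : N} :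
    rv (Radius.ofNat O m) x = rv (Radius.ofNat O m) y ↔
      x = y ∨ O.valuation (x - y) < O.valuation ((m : ℕ) * y) := by
  rw [rv_eq_rv_iff, map_mul]; rfl

theorem rv_ofNat_eq_of_dvd [CharZero N] {m n : ℕ+} (h : m ∣ n) {x y : N}
    (hxy : rv (Radius.ofNat O n) x = rv (Radius.ofNat O n) y) :
    rv (Radius.ofNat O m) x = rv (Radius.ofNat O m) y := by
  rw [rv_ofNat_eq_iff] at *
  refine hxy.imp_right fun h' => h'.trans_le ?_
  obtain ⟨k, rfl⟩ := h
  rw [PNat.mul_coe, Nat.cast_mul, mul_right_comm, map_mul _ _ ((k : ℕ) : N)]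
  exact mul_le_of_le_one_right' (valuation_natCast_le_one O k)

theorem Prepares.mono [CharZero N] {m n : ℕ+} (h : m ∣ n) {C D X : Set N} (hCD : C ⊆ D)
    (hC : Prepares (Radius.ofNat O m) C X) : Prepares (Radius.ofNat O n) D X :=
  fun x x' hx => hC x x' fun c hc => rv_ofNat_eq_of_dvd h (hx c (hCD hc))

theorem rv_ofNat_eq_of_valuation_lt [CharZero N] {m : ℕ+} {x y : N}
    (h : O.valuation (x - y) < O.valuation ((m : ℕ) * x)) :
    rv (Radius.ofNat O m) x = rv (Radius.ofNat O m) y := by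
  symm
  rw [rv_ofNat_eq_iff, Valuation.map_sub_swap]
  exact Or.inr h

theorem valuation_le_iff_exists {a b : N} :
    O.valuation a ≤ O.valuation b ↔ ∃ z ∈ O, a = z * b := by
  constructor
  · intro h
    by_cases hb : b = 0
    · subst hb
      exact ⟨0, O.zero_mem, by simpa using h⟩
    · refine ⟨a / b, ?_, by field_simp⟩
      rw [← O.valuation_le_one_iff, map_div₀]
      exact div_le_one_of_le₀ h zero_le
  · rintro ⟨z, hz, rfl⟩
    rw [map_mul]
    exact mul_le_of_le_one_left' ((O.valuation_le_one_iff _).2 hz)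

theorem valuation_eq_of_rv_eq {lam : Radius O} {x y : N} (h : rv lam x = rv lam y) :
    O.valuation x = O.valuation y := by
  rcases rv_eq_rv_iff.1 h with rfl | h
  · rfl
  · refine Valuation.map_eq_of_sub_lt _ (h.trans_le ?_)
    exact mul_le_of_le_one_left' lam.2.2

end RVBasic

end HMin

namespace HMin

open FirstOrder FirstOrder.Language FirstOrder.Language.Structure Set

/-! ### Closure properties of definable sets; eliminating parameters from dcl. -/

section Definability

variable {L : FirstOrder.Language.{u, v}} {N : Type w} [L.Structure N] {B : Set N} {V : Type*}

theorem definable_exists {P : (V → N) → N → Prop}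
    (h : B.Definable L {w : V ⊕ Unit → N | P (fun i => w (.inl i)) (w (.inr ()))}) :
    B.Definable L {v : V → N | ∃ x, P v x} := by
  convert! h.exists_of_finite using 1
  ext v
  exact ⟨fun ⟨x, hx⟩ => ⟨fun _ => x, hx⟩, fun ⟨x, hx⟩ => ⟨x (), hx⟩⟩

theorem definable_and {P Q : (V → N) → Prop} (hP : B.Definable L {v | P v})
    (hQ : B.Definable L {v | Q v}) : B.Definable L {v | P v ∧ Q v} :=
  hP.inter hQ

theorem definable_or {P Q : (V → N) → Prop} (hP : B.Definable L {v | P v})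
    (hQ : B.Definable L {v | Q v}) : B.Definable L {v | P v ∨ Q v} :=
  hP.union hQ

theorem definable_not {P : (V → N) → Prop} (hP : B.Definable L {v | P v}) :
    B.Definable L {v | ¬ P v} :=
  hP.compl

theorem definable_imp {P Q : (V → N) → Prop} (hP : B.Definable L {v | P v})
    (hQ : B.Definable L {v | Q v}) : B.Definable L {v | P v → Q v} := by
  simpa only [imp_iff_not_or] using definable_or (definable_not hP) hQ

theorem definable_forall {P : (V → N) → N → Prop}
    (h : B.Definable L {w : V ⊕ Unit → N | P (fun i => w (.inl i)) (w (.inr ()))}) :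
    B.Definable L {v : V → N | ∀ x, P v x} := by
  simpa only [not_exists, not_not] using
    definable_not (definable_exists (P := fun v x => ¬ P v x) (definable_not h))

/-- The function `t` is given by a term of `L` with parameters from `B`. -/
def IsTerm (L : FirstOrder.Language.{u, v}) [L.Structure N] (B : Set N) (t : (V → N) → N) : Prop :=
  ∃ τ : L[[B]].Term V, ∀ v, τ.realize v = t v

theorem isTerm_var (i : V) : IsTerm L B fun v : V → N => v i :=
  ⟨Term.var i, fun _ => rfl⟩

theorem isTerm_const {b : N} (hb : b ∈ B) : IsTerm L B fun _ : V → N => b :=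
  ⟨(L.con (⟨b, hb⟩ : B)).term, fun _ => by simp⟩

theorem IsTerm.inl {t : (V → N) → N} (ht : IsTerm L B t) {W : Type*} :
    IsTerm L B fun v : V ⊕ W → N => t fun i => v (.inl i) := by
  obtain ⟨τ, hτ⟩ := ht
  exact ⟨τ.relabel .inl, fun v => by rw [Term.realize_relabel, hτ]; rfl⟩

theorem isTerm_funMap {n : ℕ} (f : L.Functions n) {t : Fin n → (V → N) → N}
    (ht : ∀ i, IsTerm L B (t i)) : IsTerm L B fun v => funMap f fun i => t i v := by
  choose τ hτ using ht
  refine ⟨Term.func (Sum.inl f : L[[B]].Functions n) τ, fun v => ?_⟩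
  simp only [Term.realize, hτ]
  rfl

theorem definable_relMap {n : ℕ} (r : L.Relations n) {t : Fin n → (V → N) → N}
    (ht : ∀ i, IsTerm L B (t i)) : B.Definable L {v | RelMap r fun i => t i v} := by
  choose τ hτ using ht
  let r' : L[[B]].Relations n := Sum.inl r
  refine ⟨r'.formula τ, ?_⟩
  ext v
  rw [mem_ofPred_eq, mem_ofPred_eq, Formula.realize_rel]
  simp only [hτ]
  rfl

theorem definable_eq {s t : (V → N) → N} (hs : IsTerm L B s) (ht : IsTerm L B t) :
    B.Definable L {v | s v = t v} := by
  obtain ⟨σ, hσ⟩ := hs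
  obtain ⟨τ, hτ⟩ := ht
  refine ⟨σ.equal τ, ?_⟩
  ext v
  simp [hσ, hτ]

theorem definable_subst {W : Type*} {X : Set (W → N)} (hX : B.Definable L X)
    {t : W → (V → N) → N} (ht : ∀ i, IsTerm L B (t i)) :
    B.Definable L {v | (fun i => t i v) ∈ X} := by
  obtain ⟨θ, rfl⟩ := hX
  choose τ hτ using ht
  refine ⟨BoundedFormula.subst θ τ, ?_⟩
  ext v
  simp only [mem_ofPred_eq, Formula.Realize, BoundedFormula.realize_subst, hτ]

theorem definable_mem {X : Set N} (hX : B.Definable₁ L X) {t : (V → N) → N}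
    (ht : IsTerm L B t) : B.Definable L {v | t v ∈ X} :=
  definable_subst (t := fun _ => t) hX fun _ => ht

theorem definable₁_singleton_of_mem {b : N} (hb : b ∈ B) : B.Definable₁ L {b} :=
  definable_eq (isTerm_var 0) (isTerm_const hb)

theorem definable₁_of_finite_subset {X : Set N} (hX : X.Finite) (hXB : X ⊆ B) :
    B.Definable₁ L X := by
  induction X, hX using Set.Finite.induction_on with
  | empty => exact definable_empty
  | @insert a s _ _ ih =>
    exact definable_or (definable₁_singleton_of_mem (hXB (mem_insert _ _)))
      (ih ((subset_insert _ _).trans hXB))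

/-- The parameter c is traded for one extra variable, so that a set definable over c becomes a
member of a family definable over B. -/
theorem exists_definable_fiber {c : N} {X : Set (V → N)} (hX : (B ∪ {c}).Definable L X) :
    ∃ Y : Set (V ⊕ Unit → N), B.Definable L Y ∧ X = {v | Sum.elim v (fun _ => c) ∈ Y} := by
  classical
  obtain ⟨θ, rfl⟩ := definable_iff_exists_formula_sum.1 hX
  let σ : ↥(B ∪ {c}) ⊕ V → B ⊕ (V ⊕ Unit) :=
    Sum.elim (fun b => if h : (b : N) ∈ B then .inl ⟨b, h⟩ else .inr (.inr ())) fun i =>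
      .inr (.inl i)
  refine ⟨_, definable_iff_exists_formula_sum.2 ⟨θ.relabel σ, rfl⟩, ?_⟩
  ext v
  simp only [mem_ofPred_eq, Formula.realize_relabel]
  refine iff_of_eq (congrArg _ ?_)
  ext (b | i)
  · by_cases h : (b : N) ∈ B
    · simp [σ, h]
    · have : (b : N) = c := b.2.resolve_left h
      simp only [σ, Function.comp_apply, Sum.elim_inl, dif_neg h, Sum.elim_inr]
      exact this
  · simp [σ]

theorem definable_of_insert_mem_dcl {c : N} (hc : c ∈ dcl L B) {X : Set (V → N)}
    (hX : (B ∪ {c}).Definable L X) : B.Definable L X := by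
  obtain ⟨Y, hY, rfl⟩ := exists_definable_fiber hX
  have h : B.Definable L {v : V → N | ∃ x, x ∈ ({c} : Set N) ∧ Sum.elim v (fun _ => x) ∈ Y} := by
    refine definable_exists (definable_and (definable_mem hc (isTerm_var _)) ?_)
    convert! hY using 1
    ext w
    refine iff_of_eq (congrArg (· ∈ Y) ?_)
    ext (i | i) <;> rfl
  simpa using h

/-- A formula uses only finitely many parameters, and these are eliminated one at a time by
quantifying over the B-definable singletons containing them. -/
theorem definable_of_dcl {X : Set (V → N)} (hX : (dcl L B).Definable L X) : B.Definable L X := by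
  classical
  obtain ⟨A₀, hA₀, h⟩ := definable_iff_finitely_definable.1 hX
  have key : ∀ F : Finset N, (F : Set N) ⊆ dcl L B →
      (B ∪ (F : Set N)).Definable L X → B.Definable L X := by
    intro F
    induction F using Finset.induction_on with
    | empty => intro _ h; simpa using h
    | insert a F _ ih =>
      intro hF h
      rw [Finset.coe_insert] at hF h
      refine ih ((subset_insert _ _).trans hF) (definable_of_insert_mem_dcl (c := a) ?_ ?_)
      · exact (hF (mem_insert _ _)).mono subset_union_left
      · convert h using 1
        ext; simp
  exact key A₀ hA₀ (h.mono subset_union_right)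

theorem subset_dcl : B ⊆ dcl L B := fun _ hb => definable₁_singleton_of_mem hb

theorem dcl_subset_acl : dcl L B ⊆ acl L B := fun b hb => ⟨{b}, finite_singleton b, hb, rfl⟩

end Definability

/-! ### Definability of the field operations, the valuation and equality of leading terms. -/

section Expansion

variable {L : FirstOrder.Language.{u, v}} {φ : valuedField →ᴸ L} {N : Type w} [Field N]
  {O : ValuationSubring N} [L.Structure N]

/-- The function symbol of `L` corresponding to a symbol of the language of rings. -/
def ringSymbol (φ : valuedField →ᴸ L) {n : ℕ} (f : Language.ring.Functions n) : L.Functions n :=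
  φ.onFunction (Sum.inl f)

/-- The relation symbol of `L` naming the valuation ring. -/
def integerSymbol (φ : valuedField →ᴸ L) : L.Relations 1 :=
  φ.onRelation (Sum.inr ValRel.integer)

theorem IsExpansion.funMap_add (h : IsExpansion φ O) (x : Fin 2 → N) :
    funMap (ringSymbol φ Ring.addFunc) x = x 0 + x 1 :=
  letI := valuedFieldStructure O
  h.map_onFunction _ _

theorem IsExpansion.funMap_mul (h : IsExpansion φ O) (x : Fin 2 → N) :
    funMap (ringSymbol φ Ring.mulFunc) x = x 0 * x 1 :=
  letI := valuedFieldStructure O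
  h.map_onFunction _ _

theorem IsExpansion.funMap_neg (h : IsExpansion φ O) (x : Fin 1 → N) :
    funMap (ringSymbol φ Ring.negFunc) x = - x 0 :=
  letI := valuedFieldStructure O
  h.map_onFunction _ _

theorem IsExpansion.funMap_zero (h : IsExpansion φ O) (x : Fin 0 → N) :
    funMap (ringSymbol φ Ring.zeroFunc) x = (0 : N) :=
  letI := valuedFieldStructure O
  h.map_onFunction _ _

theorem IsExpansion.funMap_one (h : IsExpansion φ O) (x : Fin 0 → N) :
    funMap (ringSymbol φ Ring.oneFunc) x = (1 : N) :=
  letI := valuedFieldStructure O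
  h.map_onFunction _ _

theorem IsExpansion.relMap_integer (h : IsExpansion φ O) (x : Fin 1 → N) :
    RelMap (integerSymbol φ) x ↔ x 0 ∈ O :=
  letI := valuedFieldStructure O
  iff_of_eq (h.map_onRelation _ _)

variable {B : Set N} {V : Type*}

theorem IsExpansion.isTerm_add (h : IsExpansion φ O) {s t : (V → N) → N} (hs : IsTerm L B s)
    (ht : IsTerm L B t) : IsTerm L B fun v => s v + t v := by
  simpa only [h.funMap_add, Matrix.cons_val_zero, Matrix.cons_val_one] using
    isTerm_funMap (ringSymbol φ Ring.addFunc) (t := ![s, t]) (Fin.forall_fin_two.2 ⟨hs, ht⟩)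

theorem IsExpansion.isTerm_mul (h : IsExpansion φ O) {s t : (V → N) → N} (hs : IsTerm L B s)
    (ht : IsTerm L B t) : IsTerm L B fun v => s v * t v := by
  simpa only [h.funMap_mul, Matrix.cons_val_zero, Matrix.cons_val_one] using
    isTerm_funMap (ringSymbol φ Ring.mulFunc) (t := ![s, t]) (Fin.forall_fin_two.2 ⟨hs, ht⟩)

theorem IsExpansion.isTerm_neg (h : IsExpansion φ O) {s : (V → N) → N} (hs : IsTerm L B s) :
    IsTerm L B fun v => - s v := by
  simpa only [h.funMap_neg] using
    isTerm_funMap (ringSymbol φ Ring.negFunc) (t := fun _ => s) fun _ => hs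

theorem IsExpansion.isTerm_sub (h : IsExpansion φ O) {s t : (V → N) → N} (hs : IsTerm L B s)
    (ht : IsTerm L B t) : IsTerm L B fun v => s v - t v := by
  simpa only [sub_eq_add_neg] using h.isTerm_add hs (h.isTerm_neg ht)

theorem IsExpansion.isTerm_natCast (h : IsExpansion φ O) (n : ℕ) :
    IsTerm L B fun _ : V → N => (n : N) := by
  induction n with
  | zero =>
    simpa only [h.funMap_zero, Nat.cast_zero] using
      isTerm_funMap (N := N) (B := B) (V := V) (ringSymbol φ Ring.zeroFunc) (t := Fin.elim0)
        fun i => i.elim0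
  | succ n ih =>
    simp only [Nat.cast_succ]
    refine h.isTerm_add ih ?_
    simpa only [h.funMap_one] using
      isTerm_funMap (N := N) (B := B) (V := V) (ringSymbol φ Ring.oneFunc) (t := Fin.elim0)
        fun i => i.elim0

theorem IsExpansion.definable_mem_integer (h : IsExpansion φ O) {t : (V → N) → N}
    (ht : IsTerm L B t) : B.Definable L {v | t v ∈ O} := by
  simpa only [h.relMap_integer] using definable_relMap (integerSymbol φ) (t := fun _ => t) fun _ => ht

theorem IsExpansion.definable_valuation_le (h : IsExpansion φ O) {s t : (V → N) → N}
    (hs : IsTerm L B s) (ht : IsTerm L B t) :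
    B.Definable L {v | O.valuation (s v) ≤ O.valuation (t v)} := by
  simp only [valuation_le_iff_exists]
  exact definable_exists (definable_and (h.definable_mem_integer (isTerm_var _))
    (definable_eq hs.inl (h.isTerm_mul (isTerm_var _) ht.inl)))

theorem IsExpansion.definable_rv_eq (h : IsExpansion φ O) [CharZero N] (m : ℕ+)
    {s t : (V → N) → N} (hs : IsTerm L B s) (ht : IsTerm L B t) :
    B.Definable L {v | rv (Radius.ofNat O m) (s v) = rv (Radius.ofNat O m) (t v)} := by
  simp only [rv_ofNat_eq_iff, ← not_le]
  exact definable_or (definable_eq hs ht) (definable_not (h.definable_valuation_le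
    (h.isTerm_mul (h.isTerm_natCast _) ht) (h.isTerm_sub hs ht)))

end Expansion

end HMin

namespace HMin

open FirstOrder FirstOrder.Language FirstOrder.Language.Structure Set Filter

/-! ### Ultrapowers of expansions of valued fields. -/

section Ultrapower

variable {L : FirstOrder.Language.{u, v}} {φ : valuedField →ᴸ L} {I : Type*} (U : Ultrafilter I)
  {M : Type w}

/-- The structure on an ultrapower. -/
@[reducible] def germStructure [L.Structure M] : L.Structure (Germ (U : Filter I) M) :=
  Ultraproduct.structure (M := fun _ => M) (u := U)

attribute [local instance] germStructure

theorem realize_germ [L.Structure M] [Nonempty M] {β : Type*} (θ : L.Formula β) (x : β → I → M) :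
    θ.Realize (fun b => (x b : Germ (U : Filter I) M)) ↔ ∀ᶠ i in U, θ.Realize fun b => x b i :=
  Ultraproduct.realize_formula_cast (M := fun _ => M) θ x

/-- The diagonal embedding into an ultrapower. -/
def germConst [L.Structure M] [Nonempty M] : M ↪ₑ[L] Germ (U : Filter I) M where
  toFun a := (a : Germ (U : Filter I) M)
  map_formula' _ θ x := (realize_germ U θ fun b _ => x b).trans eventually_const

variable [Field M] (O : ValuationSubring M)

/-- The ultrapower of a valuation ring. -/
def germValuationSubring : ValuationSubring (Germ (U : Filter I) M) where
  carrier := {x | x.LiftPred (· ∈ O)}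
  mul_mem' {a b} ha hb := by
    induction a using Germ.inductionOn
    induction b using Germ.inductionOn
    exact (Eventually.and ha hb).mono fun i h => O.mul_mem _ _ h.1 h.2
  add_mem' {a b} ha hb := by
    induction a using Germ.inductionOn
    induction b using Germ.inductionOn
    exact (Eventually.and ha hb).mono fun i h => O.add_mem _ _ h.1 h.2
  one_mem' := Eventually.of_forall fun _ => O.one_mem
  zero_mem' := Eventually.of_forall fun _ => O.zero_mem
  neg_mem' {a} ha := by
    induction a using Germ.inductionOn
    exact Eventually.mono ha fun i h => O.neg_mem _ h
  mem_or_inv_mem' a := by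
    induction a using Germ.inductionOn with
    | _ f => exact Ultrafilter.eventually_or.1 (Eventually.of_forall fun i => O.mem_or_inv_mem (f i))

variable {O}

variable [L.Structure M]

theorem IsExpansion.germ (h : IsExpansion φ O) : IsExpansion φ (germValuationSubring U O) := by
  let := valuedFieldStructure O
  let := valuedFieldStructure (germValuationSubring U O)
  refine ⟨fun {n} f x => ?_, fun {n} r x => ?_⟩
  · obtain ⟨y, rfl⟩ : ∃ y : Fin n → I → M, x = fun i => (y i : Germ (U : Filter I) M) :=
      ⟨fun i => (x i).out, funext fun i => (Quotient.out_eq' _).symm⟩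
    refine (Ultraproduct.funMap_cast (M := fun _ => M) (u := U) (φ.onFunction f) y).trans ?_
    have e : (fun a => funMap (φ.onFunction f) fun i => y i a) = fun a => funMap f fun i => y i a :=
      funext fun a => h.map_onFunction f _
    rw [e]
    rcases f with f | f
    · cases f <;> rfl
    · exact f.elim
  · obtain ⟨y, rfl⟩ : ∃ y : Fin n → I → M, x = fun i => (y i : Germ (U : Filter I) M) :=
      ⟨fun i => (x i).out, funext fun i => (Quotient.out_eq' _).symm⟩
    rcases r with r | r
    · exact r.elim
    cases r
    refine propext ?_
    refine (relMap_quotient_mk' (s := productSetoid (U : Filter I) fun _ => M)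
      (ps := Ultraproduct.setoidPrestructure (fun _ => M) U) _ _).trans ?_
    exact eventually_congr (Eventually.of_forall fun i => iff_of_eq (h.map_onRelation _ _))

theorem germ_charZero [CharZero M] : CharZero (Germ (U : Filter I) M) :=
  ⟨fun a b hab => by
    have : ∀ᶠ _ in (U : Filter I), (a : M) = b := Quotient.exact' hab
    exact Nat.cast_injective (eventually_const.1 this)⟩

end Ultrapower

end HMin

namespace HMin

open FirstOrder FirstOrder.Language FirstOrder.Language.Structure Set Filter

attribute [local instance] germStructure

/-! ### Preparation uniform in the leading-term parameter. -/

section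

variable {L : FirstOrder.Language.{u, v}} {φ : valuedField →ᴸ L} {M : Type w}

/-- Indexing the parameters by A rather than by its image lets the same formula be read in M and in
N. -/
theorem definable_image_iff [L.Structure M] {N : Type*} [L.Structure N] {A : Set M} {V : Type*}
    (g : M → N) {X : Set (V → N)} :
    (g '' A).Definable L X ↔
      ∃ ψ : L.Formula (A ⊕ V), X = {v | ψ.Realize (Sum.elim (fun a => g a) v)} := by
  rw [definable_iff_exists_formula_sum]
  constructor
  · rintro ⟨ψ, rfl⟩
    choose σ hσ using fun b : g '' A => b.2
    refine ⟨ψ.relabel (Sum.map (fun b => ⟨σ b, (hσ b).1⟩) id), ?_⟩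
    ext v
    simp only [mem_ofPred_eq, Formula.realize_relabel]
    refine iff_of_eq (congrArg _ ?_)
    ext (b | i)
    · simp [(hσ b).2]
    · rfl
  · rintro ⟨ψ, rfl⟩
    refine ⟨ψ.relabel (Sum.map (fun a : A => ⟨g a, mem_image_of_mem g a.2⟩) id), ?_⟩
    ext v
    simp only [mem_ofPred_eq, Formula.realize_relabel]
    refine iff_of_eq (congrArg _ ?_)
    ext (b | i) <;> rfl

theorem realize_germ_sumElim [L.Structure M] [Nonempty M] {I : Type*} (U : Ultrafilter I)
    {A : Set M} {V : Type*} (θ : L.Formula (A ⊕ V)) (x : V → I → M) :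
    θ.Realize (Sum.elim (fun a => germConst (L := L) U (a : M))
        fun b => (x b : Germ (U : Filter I) M)) ↔
      ∀ᶠ i in U, θ.Realize (Sum.elim (↑) fun b => x b i) := by
  convert! realize_germ U θ (Sum.elim (fun a _ => (a : M)) x) using 3
  · rename_i b
    rcases b with b | b <;> rfl
  · rename_i i
    refine iff_of_eq (congrArg _ ?_)
    ext (b | b) <;> rfl

/-- The fibre over `ξ` of the smallest set that contains `W` and is invariant under `rv_m` in the
second coordinate. -/
def rvFiber [Field M] [CharZero M] (O : ValuationSubring M) (m : ℕ+) (W : Set (Fin 2 → M)) (ξ : M) :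
    Set M :=
  {x | ∃ ξ', rv (Radius.ofNat O m) ξ' = rv (Radius.ofNat O m) ξ ∧ ![x, ξ'] ∈ W}

variable [Field M] {O : ValuationSubring M}

/-- Only membership in the valuation ring is mentioned, which avoids comparing the value group of an
ultrapower with that of M. -/
theorem rv_ofNat_eq_iff_notMem [CharZero M] {m : ℕ+} {x y : M} :
    rv (Radius.ofNat O m) x = rv (Radius.ofNat O m) y ↔ x = y ∨ (m : ℕ) * y / (x - y) ∉ O := by
  rw [rv_ofNat_eq_iff]
  by_cases h : x = y
  · simp [h]
  · have h' : 0 < O.valuation (x - y) := zero_lt_iff.2 ((Valuation.ne_zero_iff _).2 (sub_ne_zero.2 h))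
    rw [← O.valuation_le_one_iff, map_div₀, div_le_one₀ h', not_le]

variable [L.Structure M]

theorem IsExpansion.definable_rvFiber [CharZero M] (h : IsExpansion φ O) {B : Set M} {m : ℕ+}
    {W : Set (Fin 2 → M)} (hW : B.Definable L W) {V : Type*} {s t : (V → M) → M}
    (hs : IsTerm L B s) (ht : IsTerm L B t) :
    B.Definable L {v | s v ∈ rvFiber O m W (t v)} := by
  refine definable_exists (definable_and (h.definable_rv_eq m (isTerm_var _) ht.inl) ?_)
  convert! definable_subst hW (t := ![fun v : V ⊕ Unit → M => s fun i => v (.inl i),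
    fun v => v (.inr ())]) (Fin.forall_fin_two.2 ⟨hs.inl, isTerm_var _⟩) using 1
  ext v
  refine iff_of_eq (congrArg (· ∈ W) ?_)
  ext i
  fin_cases i <;> rfl

theorem IsExpansion.definableOverRV_rvFiber [CharZero M] (h : IsExpansion φ O) {B : Set M} {m : ℕ+}
    {W : Set (Fin 2 → M)} (hW : B.Definable L W) (ξ : M) :
    DefinableOverRV L B (Radius.ofNat O m) (rvFiber O m W ξ) :=
  ⟨1, {z | ∃ ξ', rv (Radius.ofNat O m) ξ' = z.2 0 ∧ ![z.1, ξ'] ∈ W}, fun _ => rv _ ξ,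
    h.definable_rvFiber (V := Fin 2) hW (isTerm_var 0) (isTerm_var 1), rfl⟩

section Germ

variable {I : Type*} (U : Ultrafilter I) [CharZero M] [CharZero (Germ (U : Filter I) M)]

theorem rv_germ_eq_iff {m : ℕ+} {x y : I → M} :
    rv (Radius.ofNat (germValuationSubring U O) m) (x : Germ (U : Filter I) M) =
        rv (Radius.ofNat (germValuationSubring U O) m) (y : Germ (U : Filter I) M) ↔
      ∀ᶠ i in U, rv (Radius.ofNat O m) (x i) = rv (Radius.ofNat O m) (y i) := by
  simp only [rv_ofNat_eq_iff_notMem]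
  rw [Ultrafilter.eventually_or, Ultrafilter.eventually_not]
  exact or_congr Quotient.eq'' Iff.rfl

theorem mem_rvFiber_germ_iff {m : ℕ+} {W : Set (Fin 2 → M)}
    {W' : Set (Fin 2 → Germ (U : Filter I) M)}
    (hW : ∀ x : Fin 2 → I → M,
      (fun b => (x b : Germ (U : Filter I) M)) ∈ W' ↔ ∀ᶠ i in U, (fun b => x b i) ∈ W)
    {x ξ : I → M} :
    (x : Germ (U : Filter I) M) ∈ rvFiber (germValuationSubring U O) m W' ξ ↔
      ∀ᶠ i in U, x i ∈ rvFiber O m W (ξ i) := by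
  have e : ∀ y : I → M, ![(x : Germ (U : Filter I) M), (y : Germ (U : Filter I) M)] ∈ W' ↔
      ∀ᶠ i in U, ![x i, y i] ∈ W := by
    intro y
    convert! hW ![x, y] using 2
    · ext b
      fin_cases b <;> rfl
    · ext i
      refine iff_of_eq (congrArg (· ∈ W) ?_)
      ext b
      fin_cases b <;> rfl
  constructor
  · rintro ⟨ξ', h1, h2⟩
    induction ξ' using Germ.inductionOn with
    | _ y =>
      filter_upwards [(rv_germ_eq_iff U).1 h1, (e y).1 h2] with i h3 h4
      exact ⟨y i, h3, h4⟩
  · intro h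
    have : ∀ i, ∃ y, x i ∈ rvFiber O m W (ξ i) →
        rv (Radius.ofNat O m) y = rv (Radius.ofNat O m) (ξ i) ∧ ![x i, y] ∈ W := by
      intro i
      by_cases hi : x i ∈ rvFiber O m W (ξ i)
      · obtain ⟨y, hy⟩ := hi
        exact ⟨y, fun _ => hy⟩
      · exact ⟨0, fun h => absurd h hi⟩
    choose y hy using this
    exact ⟨y, (rv_germ_eq_iff U).2 (h.mono fun i hi => (hy i hi).1),
      (e y).2 (h.mono fun i hi => (hy i hi).2)⟩

end Germ

/-- Compactness, via an ultrapower. If no finite set s of candidates (formula, m) serves every ξ,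
each s has a bad ξ_s. In an ultrapower indexed by these s, the fibre over the germ of (ξ_s) is
prepared by one candidate, which contradicts badness at large s. This ultrapower is what requires
models in universe `max u v w`. -/
theorem exists_uniform_preparation [CharZero M] (hM : IsExpansion φ O)
    (hprep : ∀ (N : Type max u v w) [Field N] [CharZero N] (O' : ValuationSubring N)
      [L.Structure N], IsExpansion φ O' → (M ↪ₑ[L] N) →
      ∀ (m' : ℕ+) (A X : Set N), DefinableOverRV L A (Radius.ofNat O' m') X →
        ∃ (m : ℕ+) (C : Set N), C.Finite ∧ A.Definable₁ L C ∧ Prepares (Radius.ofNat O' m) C X)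
    {A : Set M} {W : Set (Fin 2 → M)} (hW : A.Definable L W) (m' : ℕ+) :
    ∃ (m : ℕ+) (C : Set M), C.Finite ∧ A.Definable₁ L C ∧
      ∀ ξ, Prepares (Radius.ofNat O m) C (rvFiber O m' W ξ) := by
  classical
  obtain ⟨θ, rfl⟩ := definable_iff_exists_formula_sum.1 hW
  let C : L.Formula (A ⊕ Fin 1) × ℕ+ → Set M := fun t => {x | t.1.Realize (Sum.elim (↑) fun _ => x)}
  set W : Set (Fin 2 → M) := {v | θ.Realize (Sum.elim (↑) v)} with hWdef
  have claim : ∃ s : Finset (L.Formula (A ⊕ Fin 1) × ℕ+), ∀ ξ, ∃ t ∈ s, (C t).Finite ∧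
      Prepares (Radius.ofNat O t.2) (C t) (rvFiber O m' W ξ) := by
    by_contra! hcon
    choose ξ hξ using hcon
    let U : Ultrafilter (Finset (L.Formula (A ⊕ Fin 1) × ℕ+)) := Ultrafilter.of atTop
    have : CharZero (Germ (U : Filter (Finset (L.Formula (A ⊕ Fin 1) × ℕ+))) M) := germ_charZero U
    let g : M ↪ₑ[L] Germ (U : Filter (Finset (L.Formula (A ⊕ Fin 1) × ℕ+))) M := germConst U
    let W' : Set (Fin 2 → Germ (U : Filter (Finset (L.Formula (A ⊕ Fin 1) × ℕ+))) M) :=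
      {v | θ.Realize (Sum.elim (fun a => g a) v)}
    have hW' : (g '' A).Definable L W' := (definable_image_iff g).2 ⟨θ, rfl⟩
    have hN := hM.germ U
    have hWW' : ∀ x : Fin 2 → Finset (L.Formula (A ⊕ Fin 1) × ℕ+) → M,
        (fun b => (x b : Germ (U : Filter (Finset (L.Formula (A ⊕ Fin 1) × ℕ+))) M)) ∈ W' ↔ ∀ᶠ i in U, (fun b => x b i) ∈ W :=
      fun x => realize_germ_sumElim U θ x
    obtain ⟨m, C', hC'fin, hC'def, hC'⟩ := hprep _ (germValuationSubring U O) hN g m' (g '' A)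
      (rvFiber _ m' W' (ξ : Germ (U : Filter (Finset (L.Formula (A ⊕ Fin 1) × ℕ+))) M)) (hN.definableOverRV_rvFiber hW' _)
    obtain ⟨ψ, hψ⟩ := (definable_image_iff g).1 hC'def
    have hmem : ∀ c : Finset (L.Formula (A ⊕ Fin 1) × ℕ+) → M, (c : Germ (U : Filter (Finset (L.Formula (A ⊕ Fin 1) × ℕ+))) M) ∈ C' ↔ ∀ᶠ i in U, c i ∈ C (ψ, m) := by
      intro c
      have h1 : (c : Germ (U : Filter (Finset (L.Formula (A ⊕ Fin 1) × ℕ+))) M) ∈ C' ↔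
          ψ.Realize (Sum.elim (fun a => g a) fun _ => (c : Germ (U : Filter (Finset (L.Formula (A ⊕ Fin 1) × ℕ+))) M)) :=
        iff_of_eq (congrArg ((fun _ => (c : Germ (U : Filter (Finset (L.Formula (A ⊕ Fin 1) × ℕ+))) M)) ∈ ·) hψ)
      rw [h1]
      exact realize_germ_sumElim U ψ fun _ => c
    -- The diagonal embedding injects this set into the finite set `C'`.
    have hfin : (C (ψ, m)).Finite := by
      refine Finite.of_finite_image (hC'fin.subset ?_) g.injective.injOn
      rintro _ ⟨c, hc, rfl⟩
      exact (hmem fun _ => c).2 (Eventually.of_forall fun _ => hc)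
    -- A pair witnessing the failure of preparation, ordered so that x is inside and x' outside; the
    -- value 0 is a dummy where (ψ, m) ∉ s.
    have hbad : ∀ s, ∃ x x', (ψ, m) ∈ s → (∀ c ∈ C (ψ, m),
        rv (Radius.ofNat O m) (x - c) = rv (Radius.ofNat O m) (x' - c)) ∧
        x ∈ rvFiber O m' W (ξ s) ∧ x' ∉ rvFiber O m' W (ξ s) := by
      intro s
      by_cases hs : (ψ, m) ∈ s
      · have := hξ s (ψ, m) hs hfin
        simp only [Prepares, not_forall] at this
        obtain ⟨x, x', h1, h2⟩ := this
        by_cases hx : x ∈ rvFiber O m' W (ξ s)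
        · exact ⟨x, x', fun _ => ⟨h1, hx, fun hx' => h2 (iff_of_true hx hx')⟩⟩
        · exact ⟨x', x, fun _ => ⟨fun c hc => (h1 c hc).symm,
            by_contra fun hx' => h2 (iff_of_false hx hx'), hx⟩⟩
      · exact ⟨0, 0, fun h => absurd h hs⟩
    choose x x' hxx' using hbad
    have hU : ∀ᶠ s in (U : Filter (Finset (L.Formula (A ⊕ Fin 1) × ℕ+))), (ψ, m) ∈ s := by
      have : ∀ᶠ s in (atTop : Filter (Finset (L.Formula (A ⊕ Fin 1) × ℕ+))), (ψ, m) ∈ s :=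
        (eventually_ge_atTop {(ψ, m)}).mono fun s hs => hs (Finset.mem_singleton_self _)
      exact Ultrafilter.of_le atTop this
    have hiff := hC' (x : Germ (U : Filter (Finset (L.Formula (A ⊕ Fin 1) × ℕ+))) M) (x' : Germ (U : Filter (Finset (L.Formula (A ⊕ Fin 1) × ℕ+))) M) <| by
      intro c hc
      induction c using Germ.inductionOn with
      | _ c =>
        refine (rv_germ_eq_iff U (x := fun i => x i - c i) (y := fun i => x' i - c i)).2 ?_
        filter_upwards [(hmem c).1 hc, hU] with s h1 h2
        exact (hxx' s h2).1 _ h1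
    rw [mem_rvFiber_germ_iff U hWW', mem_rvFiber_germ_iff U hWW'] at hiff
    obtain ⟨s, h1, h2⟩ :=
      ((hiff.1 (hU.mono fun s hs => (hxx' s hs).2.1)).and hU).exists
    exact (hxx' s h2).2.2 h1
  obtain ⟨s, hs⟩ := claim
  -- Preparation persists when C grows and m is replaced by a multiple, so the union of the finite
  -- candidates and the product of their moduli serve every ξ.
  let s' := s.filter fun t => (C t).Finite
  refine ⟨∏ t ∈ s', t.2, ⋃ t ∈ s', C t, ?_, ?_, fun ξ => ?_⟩
  · exact s'.finite_toSet.biUnion fun t ht => (Finset.mem_filter.1 ht).2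
  · have h := definable_biUnion_finset (A := A) (L := L)
      (f := fun t => {v : Fin 1 → M | v 0 ∈ C t}) (fun t => ?_) s'
    · unfold Definable₁
      convert! h using 1
      ext v
      simp
    · refine definable_iff_exists_formula_sum.2 ⟨t.1, ?_⟩
      ext v
      have : v = fun _ => v 0 := funext fun i => congrArg v (Subsingleton.elim i 0)
      rw [this]
      rfl
  · obtain ⟨t, ht, hfin, hprep⟩ := hs ξ
    have ht' : t ∈ s' := Finset.mem_filter.2 ⟨ht, hfin⟩
    have hdvd : t.2 ∣ ∏ t ∈ s', t.2 := Finset.dvd_prod_of_mem _ ht'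
    have hsub : C t ⊆ ⋃ t ∈ s', C t := fun x hx => mem_biUnion (s := (s' : Set _)) ht' hx
    exact hprep.mono hdvd hsub

end

end HMin

namespace HMin

open FirstOrder FirstOrder.Language FirstOrder.Language.Structure Set

variable {L : FirstOrder.Language.{u, v}} {φ : valuedField →ᴸ L}

/-! ### Tarski-Vaught for the image of K; finite ramification. -/

section ElementaryEmbedding

variable {K : Type*} [L.Structure K] {M : Type*} [L.Structure M]

theorem meetsDefinable_range (f : K ↪ₑ[L] M) : L.MeetsDefinable (Set.range f) := by
  rintro D ⟨x, hx⟩ hD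
  rw [Definable₁, ← image_univ, definable_image_iff] at hD
  obtain ⟨ψ, hψ⟩ := hD
  have h : (ψ.iExs (Fin 1)).Realize (f ∘ fun a : (univ : Set K) => (a : K)) :=
    Formula.realize_iExs.2 ⟨fun _ => x, (Set.ext_iff.1 hψ fun _ => x).1 hx⟩
  rw [f.map_formula, Formula.realize_iExs] at h
  obtain ⟨k, hk⟩ := h
  rw [← f.map_formula] at hk
  refine ⟨f (k 0), (Set.ext_iff.1 hψ (f ∘ k)).2 ?_, mem_range_self _⟩
  rw [mem_ofPred_eq]
  convert hk using 1
  ext (a | i) <;> rfl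

/-- Removing from C its finitely many points in A leaves an A-definable set disjoint from A, which
must be empty. -/
theorem subset_of_meetsDefinable {A : Set M} (hA : L.MeetsDefinable A) {C : Set M}
    (hC : C.Finite) (hCA : A.Definable₁ L C) : C ⊆ A := by
  by_contra h
  have h1 : A.Definable₁ L (C ∩ A) :=
    definable₁_of_finite_subset (hC.subset inter_subset_left) inter_subset_right
  have h2 : A.Definable₁ L (C \ (C ∩ A)) := Definable.sdiff hCA h1
  obtain ⟨x, hx, hxA⟩ := hA _ (by rwa [sdiff_self_inter, sdiff_nonempty]) h2
  exact hx.2 ⟨hx.1, hxA⟩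

variable [Field K] {OK : ValuationSubring K} [Field M] {OM : ValuationSubring M}

/-- An elementary embedding of expansions of valued fields, as a homomorphism of fields. -/
def ringHomOfElementaryEmbedding (hK : IsExpansion φ OK) (hM : IsExpansion φ OM)
    (f : K ↪ₑ[L] M) : K →+* M where
  toFun := f
  map_one' := by
    have h := f.map_fun (ringSymbol φ Ring.oneFunc) ![]
    rwa [hK.funMap_one, hM.funMap_one] at h
  map_zero' := by
    have h := f.map_fun (ringSymbol φ Ring.zeroFunc) ![]
    rwa [hK.funMap_zero, hM.funMap_zero] at h
  map_add' x y := by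
    have h := f.map_fun (ringSymbol φ Ring.addFunc) ![x, y]
    rwa [hK.funMap_add, hM.funMap_add] at h
  map_mul' x y := by
    have h := f.map_fun (ringSymbol φ Ring.mulFunc) ![x, y]
    rwa [hK.funMap_mul, hM.funMap_mul] at h

theorem map_mem_integer_iff (hK : IsExpansion φ OK) (hM : IsExpansion φ OM) (f : K ↪ₑ[L] M)
    {x : K} : f x ∈ OM ↔ x ∈ OK := by
  have h := f.map_rel (integerSymbol φ) ![x]
  rwa [hK.relMap_integer, hM.relMap_integer] at h

theorem valuation_map_le_iff (hK : IsExpansion φ OK) (hM : IsExpansion φ OM) (f : K ↪ₑ[L] M)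
    {x y : K} : OM.valuation (f x) ≤ OM.valuation (f y) ↔ OK.valuation x ≤ OK.valuation y := by
  let ι := ringHomOfElementaryEmbedding hK hM f
  change OM.valuation (ι x) ≤ OM.valuation (ι y) ↔ _
  by_cases hy : y = 0
  · simp [hy]
  have h1 : 0 < OK.valuation y := zero_lt_iff.2 ((Valuation.ne_zero_iff _).2 hy)
  have h2 : 0 < OM.valuation (ι y) :=
    zero_lt_iff.2 ((Valuation.ne_zero_iff _).2 ((map_ne_zero ι).2 hy))
  rw [← div_le_one₀ h1, ← div_le_one₀ h2, ← map_div₀, ← map_div₀, ← map_div₀,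
    ValuationSubring.valuation_le_one_iff, ValuationSubring.valuation_le_one_iff]
  exact map_mem_integer_iff hK hM f

theorem charZero_of_elementaryEmbedding [CharZero K] (hK : IsExpansion φ OK)
    (hM : IsExpansion φ OM) (f : K ↪ₑ[L] M) : CharZero M :=
  charZero_of_injective_ringHom (ringHomOfElementaryEmbedding hK hM f).injective

theorem valuation_natCast_eq_one_of_map (hK : IsExpansion φ OK) (hM : IsExpansion φ OM)
    (f : K ↪ₑ[L] M) {n : ℕ} (h : OK.valuation (n : K) = 1) : OM.valuation (n : M) = 1 := by
  let ι := ringHomOfElementaryEmbedding hK hM f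
  refine le_antisymm (valuation_natCast_le_one OM n) ?_
  have h' := (valuation_map_le_iff hK hM f (x := 1) (y := n)).2 (by rw [h, map_one])
  change OM.valuation (ι 1) ≤ OM.valuation (ι n) at h'
  rwa [map_one, map_one, map_natCast] at h'

/-- Ever better approximations of α from K give a strictly decreasing sequence of values. If it
stayed above |p(α - c)|, normalising by its first term would produce infinitely many values between
|p| and 1. -/
theorem IsPCL.exists_valuation_sub_lt_of_finite (hK : IsExpansion φ OK) (hM : IsExpansion φ OM)
    (f : K ↪ₑ[L] M) {α : M} (hα : IsPCL OM (Set.range f) α) {p : ℕ}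
    (hp : IsFinitelyRamified OK p) {c : M} (hc : c ∈ Set.range f) :
    ∃ a ∈ Set.range f, OM.valuation (α - a) < OM.valuation (p * (α - c)) := by
  by_contra! hcon
  let ι := ringHomOfElementaryEmbedding hK hM f
  obtain ⟨k₀, rfl⟩ := hc
  have hnext : ∀ k : K, ∃ k' : K, OM.valuation (α - ι k') < OM.valuation (α - ι k) := by
    intro k
    obtain ⟨_, ⟨k', rfl⟩, h⟩ := hα (f k) ⟨k, rfl⟩
    exact ⟨k', h⟩
  choose next hnext using hnext
  let k : ℕ → K := fun n => next^[n] k₀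
  have hk : ∀ n, OM.valuation (α - ι (k (n + 1))) < OM.valuation (α - ι (k n)) := fun n => by
    simp only [k, Function.iterate_succ_apply']
    exact hnext _
  have hanti : StrictAnti fun n => OM.valuation (α - ι (k n)) := strictAnti_nat_of_succ_lt hk
  -- Successive differences realise the distances to α inside the value group of K, where finite
  -- ramification is assumed.
  have hd : ∀ n, OM.valuation (ι (k n - k (n + 1))) = OM.valuation (α - ι (k n)) := fun n => by
    rw [map_sub, ← sub_sub_sub_cancel_left (ι (k (n + 1))) (ι (k n)) α, Valuation.map_sub_swap]
    exact Valuation.map_sub_eq_of_lt_left _ (hk n)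
  let d : ℕ → K := fun n => k n - k (n + 1)
  have hle : ∀ {x y : K}, OM.valuation (ι x) ≤ OM.valuation (ι y) ↔
      OK.valuation x ≤ OK.valuation y := valuation_map_le_iff hK hM f
  have hdanti : StrictAnti fun n => OK.valuation (d n) := fun i j hij => by
    rw [← not_le, ← hle, not_le, hd, hd]
    exact hanti hij
  have hd0 : 0 < OK.valuation (d 0) := zero_le.trans_lt (hdanti Nat.zero_lt_one)
  refine Set.infinite_of_injective_forall_mem (f := fun n => OK.valuation (d n / d 0)) ?_ ?_ hp
  · intro i j hij
    simp only [map_div₀] at hij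
    exact hdanti.injective ((div_left_inj' hd0.ne').1 hij)
  · intro n
    constructor
    · rw [map_div₀, le_div_iff₀ hd0, ← map_mul, ← hle, map_mul ι, map_natCast, map_mul, hd, hd,
        ← map_mul]
      exact hcon _ ⟨k n, rfl⟩
    · rw [map_div₀]
      exact div_le_one_of_le₀ (hdanti.antitone n.zero_le) zero_le

end ElementaryEmbedding

/-! ### Approximating a pseudo-Cauchy limit relative to finitely many centres. -/

section PseudoCauchyLimit

variable {M : Type w} [Field M] {OM : ValuationSubring M} {A : Set M} {α : M}

/-- Gains by factors l chain together, so it suffices to treat the prime factors of m. -/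
theorem IsPCL.exists_valuation_sub_lt (hα : IsPCL OM A α)
    (h : ∀ l : ℕ, l.Prime → ∀ c ∈ A, ∃ a ∈ A, OM.valuation (α - a) < OM.valuation (l * (α - c)))
    {m : ℕ} (hm : m ≠ 0) {c : M} (hc : c ∈ A) :
    ∃ a ∈ A, OM.valuation (α - a) < OM.valuation (m * (α - c)) := by
  induction m using Nat.recOnMul generalizing c with
  | zero => exact absurd rfl hm
  | one => simpa using hα c hc
  | prime l hl => exact h l hl c hc
  | mul m n ihm ihn =>
    obtain ⟨a, ha, h1⟩ := ihm (left_ne_zero_of_mul hm) hc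
    obtain ⟨b, hb, h2⟩ := ihn (right_ne_zero_of_mul hm) ha
    refine ⟨b, hb, h2.trans_le ?_⟩
    rw [Nat.cast_mul, mul_comm (m : M), mul_assoc, map_mul _ (n : M), map_mul _ (n : M)]
    exact mul_le_mul_right h1.le _

theorem exists_forall_valuation_sub_lt {m : ℕ} (hA : A.Nonempty)
    (h : ∀ c ∈ A, ∃ a ∈ A, OM.valuation (α - a) < OM.valuation (m * (α - c))) {C : Set M}
    (hC : C.Finite) (hCA : C ⊆ A) :
    ∃ a ∈ A, ∀ c ∈ C, OM.valuation (α - a) < OM.valuation (m * (α - c)) := by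
  induction C, hC using Set.Finite.induction_on with
  | empty => exact hA.imp fun a ha => ⟨ha, by simp⟩
  | @insert c s _ _ ih =>
    obtain ⟨a, ha, h1⟩ := ih ((subset_insert _ _).trans hCA)
    obtain ⟨b, hb, h2⟩ := h c (hCA (mem_insert _ _))
    rcases le_total (OM.valuation (α - a)) (OM.valuation (α - b)) with hab | hab
    · exact ⟨a, ha, forall_mem_insert.2 ⟨hab.trans_lt h2, h1⟩⟩
    · exact ⟨b, hb, forall_mem_insert.2 ⟨h2, fun c hc => hab.trans_lt (h1 c hc)⟩⟩

end PseudoCauchyLimit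

/-- No finite set `D` admits for each of its points `x` another point `y` such that `x - y` has the
same leading term as `k`: following these points one would find a cycle. -/
theorem exists_forall_ne_or_rv_ne {M : Type w} [Field M] [CharZero M] {O : ValuationSubring M}
    {D : Set M} (hD : D.Finite) (hne : D.Nonempty) (k : M) :
    ∃ x ∈ D, ∀ y ∈ D, x ≠ y → rv (Radius.ofNat O ⟨D.ncard.factorial, Nat.factorial_pos _⟩) (x - y) ≠
      rv (Radius.ofNat O ⟨D.ncard.factorial, Nat.factorial_pos _⟩) k := by
  by_contra! hcon
  set m : ℕ+ := ⟨D.ncard.factorial, Nat.factorial_pos _⟩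
  choose! g hg hgne hgrv using hcon
  obtain ⟨x₀, hx₀⟩ := hne
  let s : ℕ → M := fun i => g^[i] x₀
  have hs : ∀ i, s i ∈ D := fun i => by
    induction i with
    | zero => exact hx₀
    | succ i ih => simp only [s, Function.iterate_succ_apply']; exact hg _ ih
  have hs1 : ∀ i, s (i + 1) = g (s i) := fun i => Function.iterate_succ_apply' _ _ _
  have hk : k ≠ 0 := by
    rintro rfl
    rcases rv_ofNat_eq_iff.1 (hgrv _ hx₀) with h | h
    · exact hgne _ hx₀ (sub_eq_zero.1 h)
    · simp at h
  have hmk : 0 < O.valuation ((m : ℕ) * k) :=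
    zero_lt_iff.2 ((Valuation.ne_zero_iff _).2 (mul_ne_zero (Nat.cast_ne_zero.2 m.ne_zero) hk))
  have herr : ∀ i, O.valuation (s i - s (i + 1) - k) < O.valuation ((m : ℕ) * k) := fun i => by
    rw [hs1]
    rcases rv_ofNat_eq_iff.1 (hgrv _ (hs i)) with h | h
    · rwa [h, sub_self, map_zero]
    · exact h
  -- Around a cycle the differences sum to 0, so the errors sum to -(j - i)k and |(j - i)k| < |mk|.
  -- But the length j - i is at most the cardinality of D, hence divides the factorial m, giving the
  -- opposite inequality.
  obtain ⟨i, j, hij, hjn, hsij⟩ : ∃ i j, i < j ∧ j ≤ D.ncard ∧ s i = s j := by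
    have hcard : hD.toFinset.card < (Finset.range (D.ncard + 1)).card := by
      rw [Finset.card_range, ← ncard_eq_toFinset_card D hD]
      exact Nat.lt_succ_self _
    obtain ⟨i, hi, j, hj, hne, he⟩ := Finset.exists_ne_map_eq_of_card_lt_of_maps_to hcard
      (f := s) fun i _ => by simpa using hs i
    rw [Finset.mem_range, Nat.lt_succ_iff] at hi hj
    rcases lt_or_gt_of_ne hne with h | h
    · exact ⟨i, j, h, hj, he⟩
    · exact ⟨j, i, h, hi, he.symm⟩
  have hsum : ∑ l ∈ Finset.range (j - i), (s (i + l) - s (i + l + 1) - k) = -((j - i : ℕ) * k) := by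
    simp only [add_assoc]
    rw [Finset.sum_sub_distrib, Finset.sum_range_sub' (fun l => s (i + l)), Nat.add_zero,
      Nat.add_sub_cancel' hij.le, hsij, sub_self, zero_sub, Finset.sum_const, Finset.card_range,
      nsmul_eq_mul]
  have hlt : O.valuation ((j - i : ℕ) * k) < O.valuation ((m : ℕ) * k) := by
    rw [← Valuation.map_neg, ← hsum]
    exact Valuation.map_sum_lt _ hmk.ne' fun l _ => herr _
  obtain ⟨r, hr⟩ : j - i ∣ (m : ℕ) :=
    Nat.dvd_factorial (Nat.sub_pos_of_lt hij) ((Nat.sub_le _ _).trans hjn)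
  refine hlt.not_ge ?_
  rw [hr, Nat.cast_mul, mul_right_comm, map_mul _ _ (r : M)]
  exact mul_le_of_le_one_right' (valuation_natCast_le_one O r)

/-! ### Leading terms of definable sets; acl, dcl and Tarski-Vaught over α. -/

section Closure

variable {M : Type w} [Field M] [CharZero M] {OM : ValuationSubring M} [L.Structure M] {A : Set M}
  {α : M}

theorem exists_rv_eq_of_definable (hM : IsExpansion φ OM) (hA : L.MeetsDefinable A)
    (hclose : ∀ m : ℕ+, ∀ c ∈ A, ∃ a ∈ A,
      OM.valuation (α - a) < OM.valuation ((m : ℕ) * (α - c)))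
    (hprep : ∀ (B : Set M) (W : Set (Fin 2 → M)), B.Definable L W → ∀ m' : ℕ+,
      ∃ (m : ℕ+) (C : Set M), C.Finite ∧ B.Definable₁ L C ∧
        ∀ ξ, Prepares (Radius.ofNat OM m) C (rvFiber OM m' W ξ))
    {Z : Set M} (hZ : (A ∪ {α}).Definable₁ L Z) (hne : Z.Nonempty) (m : ℕ+) :
    ∃ z ∈ Z, ∃ a ∈ A, rv (Radius.ofNat OM m) z = rv (Radius.ofNat OM m) a := by
  obtain ⟨Y, hY, hZY⟩ := exists_definable_fiber hZ
  let W : Set (Fin 2 → M) := {v | Sum.elim (fun _ => v 1) (fun _ => v 0) ∈ Y}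
  have hW : A.Definable L W := by
    convert! hY.preimage_comp (Sum.elim (fun _ => 1) fun _ => 0 : Fin 1 ⊕ Unit → Fin 2) using 1
    ext v
    refine iff_of_eq (congrArg (· ∈ Y) ?_)
    ext (i | i) <;> rfl
  have hWZ : ∀ z, ![α, z] ∈ W ↔ z ∈ Z := fun z => (Set.ext_iff.1 hZY fun _ => z).symm
  obtain ⟨n, C, hCfin, hCdef, hC⟩ := hprep A W hW m
  have hAne : A.Nonempty := (hA univ univ_nonempty definable_univ).mono inter_subset_right
  obtain ⟨a, ha, hac⟩ := exists_forall_valuation_sub_lt hAne (hclose n) hCfin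
    (subset_of_meetsDefinable hA hCfin hCdef)
  -- The fibres of W over α and a have the same image under `rv_m`; the uniformity of C in ξ is
  -- essential here, as a is chosen before ξ.
  have hiff : ∀ ξ, α ∈ rvFiber OM m W ξ ↔ a ∈ rvFiber OM m W ξ := fun ξ =>
    hC ξ α a fun c hc => rv_ofNat_eq_of_valuation_lt (by simpa using hac c hc)
  obtain ⟨z, hz⟩ := hne
  have hdef : A.Definable₁ L {ξ | a ∈ rvFiber OM m W ξ} :=
    hM.definable_rvFiber hW (isTerm_const ha) (isTerm_var 0)
  obtain ⟨k, hk, hkA⟩ := hA _ ⟨z, (hiff z).1 ⟨z, rfl, (hWZ z).2 hz⟩⟩ hdef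
  obtain ⟨z', h1, h2⟩ := (hiff k).2 hk
  exact ⟨z', (hWZ z').1 h2, k, hkA, h1⟩

/-- A finite definable D with two points is cut into two smaller definable pieces. Some difference
of points of D has the leading term of a k ∈ A; the starting points of such differences form a
nonempty subset, which is proper by `exists_forall_ne_or_rv_ne`. -/
theorem acl_eq_dcl (hM : IsExpansion φ OM)
    (hrv : ∀ Z : Set M, (A ∪ {α}).Definable₁ L Z → Z.Nonempty → ∀ m : ℕ+,
      ∃ z ∈ Z, ∃ a ∈ A, rv (Radius.ofNat OM m) z = rv (Radius.ofNat OM m) a) :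
    acl L (A ∪ {α}) = dcl L (A ∪ {α}) := by
  refine Subset.antisymm ?_ dcl_subset_acl
  suffices ∀ n, ∀ D : Set M, D.ncard = n → D.Finite → (A ∪ {α}).Definable₁ L D →
      D ⊆ dcl L (A ∪ {α}) by
    rintro b ⟨D, hD, hdef, hb⟩
    exact this _ D rfl hD hdef hb
  intro n
  induction n using Nat.strong_induction_on with
  | _ n ih =>
    rintro D rfl hD hdef b hb
    rcases D.subsingleton_or_nontrivial with hsub | hnt
    · have : D = {b} := hsub.eq_singleton_of_mem hb
      rwa [this] at hdef
    let m : ℕ+ := ⟨D.ncard.factorial, Nat.factorial_pos _⟩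
    have hZ : (A ∪ {α}).Definable₁ L {z | ∃ x, x ∈ D ∧ ∃ y, y ∈ D ∧ x ≠ y ∧ z = x - y} :=
      definable_exists (definable_and (definable_mem hdef (isTerm_var _)) (definable_exists
        (definable_and (definable_mem hdef (isTerm_var _)) (definable_and
          (definable_not (definable_eq (isTerm_var _) (isTerm_var _)))
          (definable_eq (isTerm_var (Sum.inl (Sum.inl 0))) (hM.isTerm_sub (isTerm_var _) (isTerm_var _)))))))
    obtain ⟨x, hx, y, hy, hxy⟩ := hnt
    obtain ⟨_, ⟨x, hx, y, hy, hxy, rfl⟩, k, hk, hrvk⟩ := hrv _ hZ ⟨x - y, x, hx, y, hy, hxy, rfl⟩ m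
    let D₁ : Set M := {x | x ∈ D ∧ ∃ y, y ∈ D ∧ x ≠ y ∧
      rv (Radius.ofNat OM m) (x - y) = rv (Radius.ofNat OM m) k}
    have hD₁ : (A ∪ {α}).Definable₁ L D₁ :=
      definable_and (definable_mem hdef (isTerm_var 0)) (definable_exists
        (definable_and (definable_mem hdef (isTerm_var _)) (definable_and
          (definable_not (definable_eq (isTerm_var (Sum.inl 0)) (isTerm_var _)))
          (hM.definable_rv_eq m (hM.isTerm_sub (isTerm_var (Sum.inl 0)) (isTerm_var _))
            (isTerm_const (Or.inl hk))))))
    have hsub : D₁ ⊆ D := fun x hx => hx.1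
    have hxD₁ : x ∈ D₁ := ⟨hx, y, hy, hxy, hrvk⟩
    obtain ⟨t, ht, ht'⟩ := exists_forall_ne_or_rv_ne (O := OM) hD ⟨x, hx⟩ k
    have htD₁ : t ∉ D₁ := fun ⟨_, y, hy, hne, h⟩ => ht' y hy hne h
    by_cases hbD : b ∈ D₁
    · refine ih _ (ncard_lt_ncard ⟨hsub, fun h => htD₁ (h ht)⟩ hD) D₁ rfl (hD.subset hsub) hD₁ hbD
    · refine ih _ (ncard_lt_ncard ⟨sdiff_subset, fun h => (h hx).2 hxD₁⟩ hD) (D \ D₁) rfl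
        (hD.subset sdiff_subset) (Definable.sdiff hdef hD₁) ⟨hb, hbD⟩

/-- The set D is prepared by a finite C ⊆ acl = dcl. Moving a point c + z of D to c + a, where a ∈ A
has the leading term of z, stays in D provided c is a point of C nearest to c + z. -/
theorem meetsDefinable_dcl (hM : IsExpansion φ OM)
    (hprep : ∀ (B : Set M) (W : Set (Fin 2 → M)), B.Definable L W → ∀ m' : ℕ+,
      ∃ (m : ℕ+) (C : Set M), C.Finite ∧ B.Definable₁ L C ∧
        ∀ ξ, Prepares (Radius.ofNat OM m) C (rvFiber OM m' W ξ))
    (hrv : ∀ Z : Set M, (A ∪ {α}).Definable₁ L Z → Z.Nonempty → ∀ m : ℕ+,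
      ∃ z ∈ Z, ∃ a ∈ A, rv (Radius.ofNat OM m) z = rv (Radius.ofNat OM m) a) :
    L.MeetsDefinable (dcl L (A ∪ {α})) := by
  intro D hDne hD
  replace hD : (A ∪ {α}).Definable₁ L D := definable_of_dcl hD
  -- The second coordinate is a dummy, so every `rvFiber` is D itself.
  obtain ⟨m, C, hCfin, hCdef, hC⟩ := hprep _ {v | v 0 ∈ D} (definable_mem hD (isTerm_var 0)) 1
  have hfib : rvFiber OM 1 {v | v 0 ∈ D} 0 = D :=
    Set.ext fun x => ⟨fun ⟨_, _, h⟩ => h, fun h => ⟨0, rfl, h⟩⟩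
  replace hC := hC 0
  rw [hfib] at hC
  have hCdcl : C ⊆ dcl L (A ∪ {α}) := by
    rw [← acl_eq_dcl hM hrv]
    exact fun c hc => ⟨C, hCfin, hCdef, hc⟩
  obtain ⟨x, hx⟩ := hDne
  rcases C.eq_empty_or_nonempty with rfl | hCne
  -- With no centres, the nonempty set D is all of M.
  · exact ⟨α, (hC x α (by simp)).1 hx, subset_dcl (Or.inr rfl)⟩
  obtain ⟨c, hc, hmin⟩ := exists_min_image C (fun c => OM.valuation (x - c)) hCfin hCne
  have hZ : (A ∪ {α}).Definable₁ L
      {z | c + z ∈ D ∧ ∀ c', c' ∈ C → OM.valuation z ≤ OM.valuation (c + z - c')} := by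
    have hcB : c ∈ A ∪ {α} ∪ {c} := Or.inr rfl
    refine definable_of_insert_mem_dcl (hCdcl hc) (definable_and
      (definable_mem (hD.mono subset_union_left) (hM.isTerm_add (isTerm_const hcB) (isTerm_var 0)))
      (definable_forall (definable_imp
        (definable_mem (hCdef.mono subset_union_left) (isTerm_var _))
        (hM.definable_valuation_le (isTerm_var (Sum.inl 0)) (hM.isTerm_sub (hM.isTerm_add
          (isTerm_const hcB) (isTerm_var (Sum.inl 0))) (isTerm_var _))))))
  obtain ⟨z, ⟨hzD, hz⟩, a, ha, hza⟩ := hrv _ hZ ⟨x - c, by simpa using hx, by simpa using hmin⟩ m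
  refine ⟨c + a, (hC (c + z) (c + a) fun c' hc' => ?_).1 hzD, ?_⟩
  · rcases rv_ofNat_eq_iff.1 hza with rfl | h
    · rfl
    refine rv_ofNat_eq_of_valuation_lt ?_
    rw [sub_sub_sub_cancel_right, add_sub_add_left_eq_sub]
    refine h.trans_le ?_
    -- Since |a| = |z| ≤ |c + z - c'|, the error z - a is negligible relative to every centre c' in
    -- C.
    rw [map_mul, map_mul, ← valuation_eq_of_rv_eq hza]
    exact mul_le_mul_right (hz c' hc') _
  · refine definable_of_insert_mem_dcl (hCdcl hc) (definable_eq (isTerm_var 0) (hM.isTerm_add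
      (isTerm_const (Or.inr rfl)) (isTerm_const (Or.inl (Or.inl ha)))))

end Closure

/-! ### Residue characteristic, immediacy and the conclusion. -/

theorem radius_ofNat_eq_one {M : Type w} [Field M] [CharZero M] {O : ValuationSubring M} {m : ℕ+}
    (h : O.valuation ((m : ℕ) : M) = 1) : Radius.ofNat O m = Radius.one O :=
  Subtype.ext h

theorem valuation_natCast_eq_one_of_ne_zero {K : Type w} [Field K] {O : ValuationSubring K} {n : ℕ}
    (h : (n : IsLocalRing.ResidueField O) ≠ 0) : O.valuation (n : K) = 1 := by
  rw [← map_natCast (IsLocalRing.residue O), IsLocalRing.residue_ne_zero_iff_isUnit,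
    O.valuation_eq_one_iff] at h
  exact_mod_cast h

theorem isImmediate_of_rv_image_eq {M : Type w} [Field M] {O : ValuationSubring M} {R S : Set M}
    (h : rv (Radius.one O) '' S = rv (Radius.one O) '' R) : IsImmediate O R S := by
  have key : ∀ {R S : Set M}, rv (Radius.one O) '' S ⊆ rv (Radius.one O) '' R →
      O.valuation '' S ⊆ O.valuation '' R ∧
        IsLocalRing.residue O '' {x : O | (x : M) ∈ S} ⊆
          IsLocalRing.residue O '' {x : O | (x : M) ∈ R} := by
    intro R S h
    constructor
    · rintro _ ⟨s, hs, rfl⟩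
      obtain ⟨r, hr, hrs⟩ := h ⟨s, hs, rfl⟩
      exact ⟨r, hr, valuation_eq_of_rv_eq hrs⟩
    · rintro _ ⟨s, hs, rfl⟩
      obtain ⟨r, hr, hrs⟩ := h ⟨(s : M), hs, rfl⟩
      have hrO : r ∈ O := by
        rw [← O.valuation_le_one_iff, valuation_eq_of_rv_eq hrs]
        exact O.valuation_le_one s
      refine ⟨⟨r, hrO⟩, hr, ?_⟩
      rw [← sub_eq_zero, ← map_sub, IsLocalRing.residue_eq_zero_iff, O.valuation_lt_one_iff]
      rcases rv_eq_rv_iff.1 hrs with e | e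
      · simp [e]
      · exact e.trans_le ((mul_le_of_le_one_left' le_rfl).trans (O.valuation_le_one s))
  exact ⟨Subset.antisymm (key h.subset).1 (key h.superset).1,
    Subset.antisymm (key h.subset).2 (key h.superset).2⟩

end HMin

theorem mainTheorem2 {L : FirstOrder.Language.{u, v}} (φ : HMin.valuedField →ᴸ L)
    {K : Type w} [Field K] [CharZero K] (OK : ValuationSubring K) [L.Structure K]
    (hK : HMin.IsExpansion φ OK)
    (hmin :
      (CharZero (IsLocalRing.ResidueField OK) ∧
        HMin.IsZeroHMinimal.{u, v, max u v w} φ (L.completeTheory K)) ∨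
      (∃ p : ℕ, p.Prime ∧ CharP (IsLocalRing.ResidueField OK) p ∧
        HMin.IsFinitelyRamified OK p ∧
        HMin.IsZeroHMixMinimal.{u, v, max u v w} φ (L.completeTheory K)))
    {M : Type w} [Field M] (OM : ValuationSubring M) [L.Structure M]
    (hM : HMin.IsExpansion φ OM) (f : K ↪ₑ[L] M)
    (α : M) (hα : HMin.IsPCL OM (Set.range f) α) :
    ∃ S : L.Substructure M,
      (S : Set M) = HMin.acl L (Set.range f ∪ {α}) ∧
      (∃ g : K ↪ₑ[L] S, ∀ a : K, ((g a : S) : M) = f a) ∧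
      HMin.rv (HMin.Radius.one OM) '' (S : Set M) =
        HMin.rv (HMin.Radius.one OM) '' Set.range f ∧
      HMin.IsImmediate OM (Set.range f) (S : Set M) ∧
      HMin.acl L (Set.range f ∪ {α}) = HMin.dcl L (Set.range f ∪ {α}) := by
  have : CharZero M := HMin.charZero_of_elementaryEmbedding hK hM f
  have hprepN : ∀ (N : Type max u v w) [Field N] [CharZero N] (O' : ValuationSubring N)
      [L.Structure N], HMin.IsExpansion φ O' → (M ↪ₑ[L] N) →
      ∀ (m' : ℕ+) (A X : Set N), HMin.DefinableOverRV L A (HMin.Radius.ofNat O' m') X →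
        ∃ (m : ℕ+) (C : Set N), C.Finite ∧ A.Definable₁ L C ∧
          HMin.Prepares (HMin.Radius.ofNat O' m) C X := by
    intro N _ _ O' _ hN g m' A X hX
    have hmodel : N ⊨ L.completeTheory K :=
      ((g.comp f).theory_model_iff _).1 inferInstance
    rcases hmin with ⟨hres, hmin⟩ | ⟨p, -, -, -, hmin⟩
    -- In residue characteristic 0 every radius |m| is 1, so 0-h-minimality already has the mixed
    -- form.
    · have hone : ∀ m : ℕ+, HMin.Radius.ofNat O' m = HMin.Radius.one O' := fun m =>
        HMin.radius_ofNat_eq_one (HMin.valuation_natCast_eq_one_of_map hK hN (g.comp f)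
          (HMin.valuation_natCast_eq_one_of_ne_zero (Nat.cast_ne_zero.2 m.ne_zero)))
      rw [hone] at hX
      obtain ⟨C, h1, h2, h3⟩ := hmin N O' hN hmodel A X hX
      exact ⟨1, C, h1, h2, by rwa [hone]⟩
    · exact hmin N O' hN hmodel m' A X hX
  have hprep := fun (B : Set M) (W : Set (Fin 2 → M)) (hW : B.Definable L W) (m' : ℕ+) =>
    HMin.exists_uniform_preparation hM hprepN hW m'
  have hA := HMin.meetsDefinable_range f
  have hone : ∀ l : ℕ, (l : IsLocalRing.ResidueField OK) ≠ 0 → OM.valuation (l : M) = 1 :=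
    fun l hl => HMin.valuation_natCast_eq_one_of_map hK hM f
      (HMin.valuation_natCast_eq_one_of_ne_zero hl)
  have hprime : ∀ l : ℕ, l.Prime → ∀ c ∈ Set.range f, ∃ a ∈ Set.range f,
      OM.valuation (α - a) < OM.valuation (l * (α - c)) := by
    intro l hl c hc
    -- Only l equal to the residue characteristic needs finite ramification; for any other prime |l|
    -- = 1.
    by_cases h : (l : IsLocalRing.ResidueField OK) = 0
    · rcases hmin with ⟨hres, -⟩ | ⟨p, hp, hchar, hram, -⟩
      · exact absurd (Nat.cast_eq_zero.1 h) hl.ne_zero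
      · obtain rfl : p = l :=
          (Nat.prime_dvd_prime_iff_eq hp hl).1 ((CharP.cast_eq_zero_iff _ p l).1 h)
        exact hα.exists_valuation_sub_lt_of_finite hK hM f hram hc
    · rw [map_mul, hone l h, one_mul]
      exact hα c hc
  have hrv := fun (Z : Set M) (hZ : (Set.range f ∪ {α}).Definable₁ L Z) (hne : Z.Nonempty) =>
    HMin.exists_rv_eq_of_definable hM hA
      (fun m c hc => hα.exists_valuation_sub_lt hprime m.ne_zero hc) hprep hZ hne
  have hacl := HMin.acl_eq_dcl hM hrv
  have hmeet := HMin.meetsDefinable_dcl hM hprep hrv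
  have hS : ((hmeet.toElementarySubstructure : L.Substructure M) : Set M) =
      HMin.dcl L (Set.range f ∪ {α}) := hmeet.closure_eq_self
  have hsub : Set.range f ⊆ HMin.dcl L (Set.range f ∪ {α}) :=
    Set.subset_union_left.trans HMin.subset_dcl
  have hrvS : HMin.rv (HMin.Radius.one OM) '' HMin.dcl L (Set.range f ∪ {α}) =
      HMin.rv (HMin.Radius.one OM) '' Set.range f := by
    refine Set.Subset.antisymm ?_ (Set.image_mono hsub)
    rintro _ ⟨b, hb, rfl⟩
    -- Since b lies in dcl, its singleton is an admissible Z.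
    obtain ⟨z, rfl, a, ha, h⟩ := hrv {b} hb (Set.singleton_nonempty b) 1
    rw [HMin.radius_ofNat_eq_one (by simp)] at h
    exact ⟨a, ha, h.symm⟩
  refine ⟨hmeet.toElementarySubstructure, hS.trans hacl.symm, ?_, ?_, ?_, hacl⟩
  · let S := hmeet.toElementarySubstructure
    have hmem : ∀ a, f a ∈ (S : L.Substructure M) := fun a => by
      rw [← SetLike.mem_coe, hS]
      exact hsub ⟨a, rfl⟩
    refine ⟨⟨fun a => ⟨f a, hmem a⟩, fun n θ x => ?_⟩, fun a => rfl⟩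
    -- The map from K to S is elementary because both K and S are elementary in M.
    exact (S.subtype.map_formula θ _).symm.trans (f.map_formula θ x)
  · rw [hS, hrvS]
  · rw [hS]
    exact HMin.isImmediate_of_rv_image_eq hrvS
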